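/- Let $k$ be a field, let $M$ be a monomial ideal in $S=k[x_1,\dots,x_n]$ minimally generated by monomials $m_1,\dots,m_r$, and let $L_M$ be its lcm-lattice, i.e. the set of least common multiples of subsets of $\{m_1,\dots,m_r\}$ (with $\operatorname{lcm}(\emptyset)=1$), ordered by divisibility. For $p\in L_M$ put $A_p=\{1\le j\le r : m_j \text{ divides } p\}$, and let $\Delta_p=\langle A_\beta : \beta \text{ is covered by } p \text{ in } L_M\rangle$ be the simplicial complex generated by these sets (so $\Delta_p=\{\emptyset\}$ if $p$ is an atom, and $\Delta_1$ has no faces). Let $\widetilde H$ denote reduced simplicial homology, where $\widetilde H_{-1}(\{\emptyset\};k)=k$ and the complex without faces has zero homology. The Betti poset $B_M\subseteq L_M$ consists of $1$ and of all $p\neq 1$ in $L_M$ such that $\widetilde H_j(\Delta_p;k)\ne 0$ for some $j$. Let $1\neq m\in B_M$ be such that $m$ is not an atom of $L_M$, and let $i\ge 0$ be an integer. Let $$\mathcal B_i(m)=\{p\in B_M : 1\ne p<m \text{ and } \widetilde H_{i-1}(\Delta_p;k)\neq 0\},$$ let $\gamma_1,\dots,\gamma_t$ be the maximal elements of $\mathcal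 B_i(m)$, and let $\Delta_m^{(i)}=\langle A_{\gamma_1},\dots,A_{\gamma_t}\rangle$, which is a subcomplex of $\Delta_m$. Let $\mathcal J_i(m)$ be the set of all $p<m$ in $L_M$ for which there is no $\gamma_j$ with $p<\gamma_j$. Let $$\sigma_m^{(i)}:\widetilde H_i(\Delta_m^{(i)};k)\to\widetilde H_i(\Delta_m;k)$$ be the $k$-linear map induced by the inclusion $\Delta_m^{(i)}\subseteq\Delta_m$. Then $\sigma_m^{(i)}$ is surjective. Moreover, if there is no $p\in\mathcal J_i(m)$ with $\widetilde H_i(\Delta_p;k)\neq 0$, then $\sigma_m^{(i)}$ is an isomorphism. -/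

import Mathlib

/-! ### Abstract simplicial complexes and their reduced homology

A simplicial complex on a finite ordered vertex set `V` is a set of subsets of `V` closed under
taking subsets, that is, a term of `LowerSet (Finset V)`. The empty set may be a face; the complex
`{∅}` and the void complex (with no faces at all) are different.  The complex generated by given
faces is Mathlib's `lowerClosure`. -/

section Homology

variable {V : Type*}

/-- The augmented chains of degree `i` of `Δ`: linear combinations of the faces of `Δ` of
dimension `i`, i.e. with `i + 1` elements. -/
def reducedChains (k : Type*) [Field k] (i : ℤ) (Δ : LowerSet (Finset V)) :
    Submodule k (Finset V → k) where
  carrier := {c | ∀ F, c F ≠ 0 → F ∈ Δ ∧ (F.card : ℤ) = i + 1}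
  zero_mem' _ hF := absurd rfl hF
  add_mem' {a b} ha hb F hF := by
    by_cases h : a F = 0
    · exact hb F fun h' => hF (by simp [h, h'])
    · exact ha F h
  smul_mem' x c hc F hF := hc F fun h => hF (by simp [h])

theorem reducedChains_mono (k : Type*) [Field k] (i : ℤ) {Δ Γ : LowerSet (Finset V)}
    (h : Δ ≤ Γ) : reducedChains k i Δ ≤ reducedChains k i Γ :=
  fun _ hc F hF => ⟨h (hc F hF).1, (hc F hF).2⟩

variable [LinearOrder V] [Fintype V]

/-- The boundary map on formal linear combinations of subsets of the finite set `V` (the linear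
combination with coefficients `c F` is the function `c : Finset V → k`, and the subset `F` itself
is `Pi.single F 1`): `∂ F = ∑ v ∈ F, (-1) ^ #{w ∈ F | w < v} • (F \ {v})`.
It is augmented: `∂ {v} = ∅`. -/
def simplicialBoundary (k : Type*) [Field k] : (Finset V → k) →ₗ[k] (Finset V → k) :=
  Fintype.linearCombination k fun F : Finset V =>
    ∑ v ∈ F, (-1 : k) ^ (F.filter (· < v)).card • Pi.single (F.erase v) (1 : k)

/-- The reduced cycles of degree `i`. -/
def reducedCycles (k : Type*) [Field k] (i : ℤ) (Δ : LowerSet (Finset V)) :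
    Submodule k (Finset V → k) :=
  reducedChains k i Δ ⊓ LinearMap.ker (simplicialBoundary (V := V) k)

/-- The boundaries of degree `i`. -/
def reducedBoundaries (k : Type*) [Field k] (i : ℤ) (Δ : LowerSet (Finset V)) :
    Submodule k (Finset V → k) :=
  (reducedChains k (i + 1) Δ).map (simplicialBoundary (V := V) k)

/-- The reduced homology `H̃_i(Δ; k)`: cycles modulo boundaries. -/
abbrev ReducedHomology (k : Type*) [Field k] (i : ℤ) (Δ : LowerSet (Finset V)) : Type _ :=
  reducedCycles k i Δ ⧸ (reducedBoundaries k i Δ).submoduleOf (reducedCycles k i Δ)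

theorem reducedCycles_mono (k : Type*) [Field k] (i : ℤ) {Δ Γ : LowerSet (Finset V)}
    (h : Δ ≤ Γ) : reducedCycles k i Δ ≤ reducedCycles k i Γ :=
  inf_le_inf_right _ (reducedChains_mono k i h)

theorem reducedBoundaries_mono (k : Type*) [Field k] (i : ℤ) {Δ Γ : LowerSet (Finset V)}
    (h : Δ ≤ Γ) : reducedBoundaries k i Δ ≤ reducedBoundaries k i Γ :=
  Submodule.map_mono (reducedChains_mono k (i + 1) h)

/-- The linear map `H̃_i(Δ; k) → H̃_i(Γ; k)` induced by the inclusion of a subcomplex `Δ` of `Γ`: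
the class of a cycle `c` is sent to the class of `c`. -/
def reducedHomologyMap (k : Type*) [Field k] (i : ℤ) {Δ Γ : LowerSet (Finset V)}
    (h : Δ ≤ Γ) : ReducedHomology k i Δ →ₗ[k] ReducedHomology k i Γ :=
  Submodule.mapQ _ _ (Submodule.inclusion (reducedCycles_mono k i h))
    fun _ hx => reducedBoundaries_mono k i h hx

end Homology

/-! ### Monomial ideals and their lcm-lattices

A monomial `x ^ a` of `k[x_1, …, x_n]` is represented by its exponent vector `a : Fin n →₀ ℕ`:
divisibility is `≤`, the least common multiple is `⊔`, and the monomial `1` is `0 = ⊥`. -/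

section Monomial

variable {n r : ℕ}

/-- `M` is minimally generated by the monomials `x ^ g 0, …, x ^ g (r - 1)`: they generate `M`, and
none of them lies in the ideal generated by the others. -/
def IsMinimallyGeneratedBy {k : Type*} [Field k] (M : Ideal (MvPolynomial (Fin n) k))
    (g : Fin r → Fin n →₀ ℕ) : Prop :=
  M = Ideal.span (Set.range fun j => MvPolynomial.monomial (g j) (1 : k)) ∧
    ∀ j, MvPolynomial.monomial (g j) (1 : k) ∉
      Ideal.span ((fun l => MvPolynomial.monomial (g l) (1 : k)) '' {l | l ≠ j})

/-- The lcm-lattice of the monomials `g`: all least common multiples of subsets of the monomials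
(that of the empty set is `1`), ordered by divisibility. -/
abbrev LcmLattice (g : Fin r → Fin n →₀ ℕ) : Type :=
  {a : Fin n →₀ ℕ // ∃ A : Finset (Fin r), A.sup g = a}

/-- The bottom element of the lcm-lattice is the monomial `1`. -/
instance (g : Fin r → Fin n →₀ ℕ) : OrderBot (LcmLattice g) where
  bot := ⟨⊥, ∅, Finset.sup_empty⟩
  bot_le _ := Subtype.mk_le_mk.2 bot_le

instance (g : Fin r → Fin n →₀ ℕ) : Finite (LcmLattice g) :=
  Set.finite_range fun A : Finset (Fin r) => A.sup g

/-- `A_m`: the set of indices of the generators dividing `m`. -/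
def divisorLabel (g : Fin r → Fin n →₀ ℕ) (m : LcmLattice g) : Finset (Fin r) :=
  Finset.univ.filter fun j => g j ≤ m.1

theorem divisorLabel_mono (g : Fin r → Fin n →₀ ℕ) {a b : LcmLattice g} (h : a ≤ b) :
    divisorLabel g a ≤ divisorLabel g b :=
  Finset.monotone_filter_right _ fun _ _ hj => le_trans hj h

/-- `Δ_m`: the simplicial complex generated by the sets `A_β` for `β` covered by `m` in the
lcm-lattice. For an atom `m` only `1` is covered by `m` and `A_1 = ∅`, so `Δ_m = {∅}`;
`Δ_1` has no faces at all. -/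
def latticeComplex (g : Fin r → Fin n →₀ ℕ) (m : LcmLattice g) : LowerSet (Finset (Fin r)) :=
  lowerClosure (divisorLabel g '' {β | β ⋖ m})

/-- The Betti poset: the elements `m` of the lcm-lattice such that `m = 1` or the reduced homology
of `Δ_m` over `k` is nonzero. -/
def bettiPoset (k : Type*) [Field k] (g : Fin r → Fin n →₀ ℕ) : Set (LcmLattice g) :=
  {m | m = ⊥ ∨ ∃ j : ℤ, Nontrivial (ReducedHomology k j (latticeComplex g m))}

/-- `𝓑_i(m)`: the elements `p ≠ 1` of the Betti poset strictly below `m` such that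
`H̃_{i-1}(Δ_p; k) ≠ 0`. -/
def bettiBelow (k : Type*) [Field k] (g : Fin r → Fin n →₀ ℕ) (i : ℤ) (m : LcmLattice g) :
    Set (LcmLattice g) :=
  {p | p ∈ bettiPoset k g ∧ p ≠ ⊥ ∧ p < m ∧
    Nontrivial (ReducedHomology k (i - 1) (latticeComplex g p))}

/-- The maximal elements `γ_1, …, γ_t` of `𝓑_i(m)`. -/
def maximalBettiBelow (k : Type*) [Field k] (g : Fin r → Fin n →₀ ℕ) (i : ℤ)
    (m : LcmLattice g) : Set (LcmLattice g) :=
  {γ | Maximal (· ∈ bettiBelow k g i m) γ}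

/-- `Δ_m^{(i)}`: the simplicial complex generated by the sets `A_γ` for `γ` maximal in `𝓑_i(m)`. -/
def approxComplex (k : Type*) [Field k] (g : Fin r → Fin n →₀ ℕ) (i : ℤ) (m : LcmLattice g) :
    LowerSet (Finset (Fin r)) :=
  lowerClosure (divisorLabel g '' maximalBettiBelow k g i m)

/-- `𝓙_i(m)`: the elements `p < m` of the lcm-lattice that are not strictly below any maximal
element of `𝓑_i(m)`. -/
def uncoveredBelow (k : Type*) [Field k] (g : Fin r → Fin n →₀ ℕ) (i : ℤ) (m : LcmLattice g) :
    Set (LcmLattice g) :=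
  {p | p < m ∧ ¬ ∃ γ ∈ maximalBettiBelow k g i m, p < γ}

theorem approxComplex_le (k : Type*) [Field k] (g : Fin r → Fin n →₀ ℕ) (i : ℤ)
    (m : LcmLattice g) : approxComplex k g i m ≤ latticeComplex g m := by
  refine lowerClosure_min ?_ (LowerSet.lower _)
  rintro _ ⟨γ, hγ, rfl⟩
  obtain ⟨β, hγβ, hβ⟩ := exists_le_covBy_of_lt hγ.prop.2.2.1
  exact ⟨_, ⟨β, hβ, rfl⟩, divisorLabel_mono g hγβ⟩

end Monomial

/-! ### The boundary map -/

section Boundary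

variable {V : Type*} [LinearOrder V] {k : Type*} [Field k]

/-! For a lower set `U` of the lcm-lattice, let Δ(U) consist of the faces whose lcm lies in `U`.
Then Δ_m = Δ(`Iio m`), and Δ_m^(i) = Δ(U) for `U` the lower closure of the γ_j. Removing a maximal
element p from a lower set removes only the faces with lcm exactly p, so the relative homology of
this step is that of the simplex A_p modulo Δ_p. In degree i ≥ 0 it vanishes if H̃_{i-1}(Δ_p) = 0,
since the simplex has no homology there (`exists_sub_boundary_mem_Iio`). Peeling off the elements of
`Iio m` outside `U` one at a time gives `exists_sub_boundary_mem_lcmComplex`. The long exact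
sequence finishes the proof. An element p < m with H̃_{i-1}(Δ_p) ≠ 0 lies below some γ_j, so
H_i(Δ_m, Δ_m^(i)) = 0 and the map is surjective. Elements outside `U` lie in 𝓙_i(m), so the extra
hypothesis kills H_{i+1}(Δ_m, Δ_m^(i)), which gives injectivity. -/

theorem neg_one_pow_card_filter_insert_of_lt {G : Finset V} {v w : V} (hv : v ∉ G) (h : v < w) :
    (-1 : k) ^ ((insert v G).filter (· < w)).card = -(-1 : k) ^ (G.filter (· < w)).card := by
  rw [Finset.filter_insert, if_pos h, Finset.card_insert_of_notMem (by simp [hv]), pow_succ]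
  ring

theorem neg_one_pow_card_filter_insert_of_gt {G : Finset V} {v w : V} (h : w < v) :
    (-1 : k) ^ ((insert v G).filter (· < w)).card = (-1 : k) ^ (G.filter (· < w)).card := by
  rw [Finset.filter_insert, if_neg h.not_gt]

variable [Fintype V]

theorem simplicialBoundary_apply (c : Finset V → k) (G : Finset V) :
    simplicialBoundary k c G =
      ∑ v ∈ Gᶜ, (-1 : k) ^ (G.filter (· < v)).card * c (insert v G) := by
  have hswap : simplicialBoundary k c G = ∑ v : V, ∑ F : Finset V,
      if v ∈ F ∧ F.erase v = G then (-1 : k) ^ (F.filter (· < v)).card * c F else 0 := by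
    rw [simplicialBoundary, Fintype.linearCombination_apply, Finset.sum_apply, Finset.sum_comm]
    refine Finset.sum_congr rfl fun F _ => ?_
    rw [Pi.smul_apply, Finset.sum_apply, smul_eq_mul, Finset.mul_sum,
      ← Finset.sum_filter_add_sum_filter_not Finset.univ (· ∈ F)]
    rw [Finset.sum_eq_zero (s := Finset.univ.filter fun v => v ∉ F)
      fun v hv => if_neg fun h => (Finset.mem_filter.1 hv).2 h.1, add_zero]
    refine Finset.sum_congr (by ext; simp) fun v hv => ?_
    by_cases h : F.erase v = G
    · subst h
      simp [(Finset.mem_filter.1 hv).2, mul_comm]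
    · simp [h, Ne.symm h]
  rw [hswap, ← Finset.sum_add_sum_compl G, Finset.sum_eq_zero, zero_add]
  · refine Finset.sum_congr rfl fun v hv => ?_
    have hv : v ∉ G := Finset.mem_compl.1 hv
    rw [Finset.sum_eq_single (insert v G)]
    · rw [if_pos ⟨Finset.mem_insert_self v G, Finset.erase_insert hv⟩, Finset.filter_insert,
        if_neg (lt_irrefl v)]
    · exact fun F _ hF => if_neg fun h => hF (by rw [← h.2, Finset.insert_erase h.1])
    · simp
  · refine fun v hv => Finset.sum_eq_zero fun F _ => if_neg ?_
    rintro ⟨-, rfl⟩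
    exact Finset.notMem_erase v F hv

theorem simplicialBoundary_simplicialBoundary (c : Finset V → k) :
    simplicialBoundary k (simplicialBoundary k c) = 0 := by
  ext G
  rw [simplicialBoundary_apply, Pi.zero_apply]
  simp_rw [simplicialBoundary_apply, Finset.mul_sum]
  rw [Finset.sum_sigma']
  -- Inserting v and w in either order gives the same set. The smaller vertex flips the sign of the
  -- larger one and not conversely, so the two terms cancel.
  refine Finset.sum_involution (fun x _ => ⟨x.2, x.1⟩) ?_ ?_ ?_ ?_
  · rintro ⟨v, w⟩ h
    simp only [Finset.mem_sigma, Finset.mem_compl, Finset.mem_insert, not_or] at h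
    obtain ⟨hv, hwv, hw⟩ := h
    simp only [Finset.insert_comm w v]
    rcases lt_or_gt_of_ne hwv with h | h
    · rw [neg_one_pow_card_filter_insert_of_lt hw h, neg_one_pow_card_filter_insert_of_gt h]
      ring
    · rw [neg_one_pow_card_filter_insert_of_lt hv h, neg_one_pow_card_filter_insert_of_gt h]
      ring
  · rintro ⟨v, w⟩ h _ heq
    simp only [Finset.mem_sigma, Finset.mem_compl, Finset.mem_insert, not_or] at h
    exact h.2.1 (congrArg Sigma.fst heq)
  · rintro ⟨v, w⟩ h
    simp only [Finset.mem_sigma, Finset.mem_compl, Finset.mem_insert, not_or] at h ⊢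
    exact ⟨h.2.2, Ne.symm h.2.1, h.1⟩
  · exact fun _ _ => rfl

theorem simplicialBoundary_mem_reducedChains {i : ℤ} {Δ : LowerSet (Finset V)}
    {c : Finset V → k} (hc : c ∈ reducedChains k (i + 1) Δ) :
    simplicialBoundary k c ∈ reducedChains k i Δ := by
  intro G hG
  rw [simplicialBoundary_apply] at hG
  obtain ⟨v, hv, h⟩ := Finset.exists_ne_zero_of_sum_ne_zero hG
  obtain ⟨hΔ, hcard⟩ := hc _ (right_ne_zero_of_mul h)
  rw [Finset.card_insert_of_notMem (Finset.mem_compl.1 hv)] at hcard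
  exact ⟨Δ.lower (Finset.subset_insert v G) hΔ, by push_cast at hcard; linarith⟩

/-- A full simplex has no reduced homology in nonnegative degrees. -/
theorem exists_boundary_eq_of_isCycle_simplex {i : ℤ} (hi : 0 ≤ i) (A : Finset V)
    {c : Finset V → k} (hc : c ∈ reducedChains k i (LowerSet.Iic A))
    (hcycle : simplicialBoundary k c = 0) :
    ∃ d ∈ reducedChains k (i + 1) (LowerSet.Iic A), simplicialBoundary k d = c := by
  rcases A.eq_empty_or_nonempty with rfl | hA
  · refine ⟨0, Submodule.zero_mem _, ?_⟩
    rw [map_zero]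
    ext F
    by_contra h
    obtain ⟨hF, hcard⟩ := hc F (Ne.symm h)
    rw [Finset.subset_empty.1 hF] at hcard
    simp only [Finset.card_empty, Nat.cast_zero] at hcard
    omega
  · have ha := A.min'_mem hA
    set a := A.min' hA with ha_def
    -- The cone over c with apex a. As a is the least vertex, joining it to a face costs no sign.
    refine ⟨fun F => if a ∈ F then c (F.erase a) else 0, ?_, ?_⟩
    · intro F hF
      have haF : a ∈ F := by
        by_contra h
        exact hF (if_neg h)
      simp only [if_pos haF] at hF
      obtain ⟨hFA, hcard⟩ := hc _ hF
      refine ⟨?_, ?_⟩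
      · rw [← Finset.insert_erase haF]
        exact Finset.insert_subset ha hFA
      · rw [← Finset.card_erase_add_one haF, Nat.cast_add, hcard, Nat.cast_one]
    · ext G
      rw [simplicialBoundary_apply]
      by_cases haG : a ∈ G
      · have hG := congrFun hcycle (G.erase a)
        have hcompl : (G.erase a)ᶜ = insert a Gᶜ := by rw [Finset.compl_erase]
        rw [simplicialBoundary_apply, hcompl, Finset.sum_insert (by simpa using haG),
          Finset.insert_erase haG, Pi.zero_apply] at hG
        have hsign : ∀ F : Finset V, c F ≠ 0 → F.filter (· < a) = ∅ := fun F hF =>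
          Finset.filter_eq_empty_iff.2 fun v hv =>
            not_lt.2 (A.min'_le v ((hc F hF).1 hv))
        have hfirst : (-1 : k) ^ ((G.erase a).filter (· < a)).card * c G = c G := by
          by_cases h : c G = 0
          · rw [h, mul_zero]
          · rw [Finset.filter_erase, hsign G h]
            simp
        rw [hfirst] at hG
        rw [← sub_eq_zero, ← neg_eq_zero, neg_sub, ← hG, sub_eq_add_neg,
          ← Finset.sum_neg_distrib]
        refine congrArg _ (Finset.sum_congr rfl fun v hv => ?_)
        have hv : v ∉ G := Finset.mem_compl.1 hv
        have hva : v ≠ a := fun h => hv (h ▸ haG)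
        rw [if_pos (Finset.mem_insert_of_mem haG), Finset.erase_insert_of_ne hva]
        by_cases h : c (insert v (G.erase a)) = 0
        · rw [h, mul_zero, mul_zero, neg_zero]
        · have hav : a < v := lt_of_le_of_ne
            (A.min'_le v ((hc _ h).1 (Finset.mem_insert_self _ _))) hva.symm
          have := neg_one_pow_card_filter_insert_of_lt (k := k) (Finset.notMem_erase a G) hav
          rw [Finset.insert_erase haG] at this
          rw [this]
          ring
      · rw [Finset.sum_eq_single a]
        · rw [if_pos (Finset.mem_insert_self a G), Finset.erase_insert haG]
          by_cases h : c G = 0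
          · rw [h, mul_zero]
          · rw [Finset.filter_eq_empty_iff.2 fun v hv =>
              not_lt.2 (A.min'_le v ((hc G h).1 hv))]
            simp
        · intro v _ hva
          rw [if_neg (by simp [haG, Ne.symm hva]), mul_zero]
        · simp [haG]

/-! ### The long exact sequence of a pair, at chain level -/

theorem mem_reducedBoundaries_of_not_nontrivial {i : ℤ} {Δ : LowerSet (Finset V)}
    (h : ¬ Nontrivial (ReducedHomology k i Δ)) {c : Finset V → k}
    (hc : c ∈ reducedChains k i Δ) (hcycle : simplicialBoundary k c = 0) :
    ∃ d ∈ reducedChains k (i + 1) Δ, simplicialBoundary k d = c := by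
  rw [not_nontrivial_iff_subsingleton, Submodule.Quotient.subsingleton_iff] at h
  exact (h ▸ Submodule.mem_top :
    (⟨c, hc, hcycle⟩ : reducedCycles k i Δ) ∈ (reducedBoundaries k i Δ).submoduleOf _)

theorem reducedHomologyMap_mk {i : ℤ} {Δ Γ : LowerSet (Finset V)} (h : Δ ≤ Γ)
    (c : reducedCycles k i Δ) :
    reducedHomologyMap k i h (Submodule.Quotient.mk c) =
      Submodule.Quotient.mk (Submodule.inclusion (reducedCycles_mono k i h) c) := rfl

/-- `H` follows from H_i(Γ, Δ) = 0: it moves every cycle of Γ into Δ by a boundary. -/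
theorem reducedHomologyMap_surjective {i : ℤ} {Δ Γ : LowerSet (Finset V)} (h : Δ ≤ Γ)
    (H : ∀ c ∈ reducedChains k i Γ, simplicialBoundary k c = 0 →
      ∃ d ∈ reducedChains k (i + 1) Γ, c - simplicialBoundary k d ∈ reducedChains k i Δ) :
    Function.Surjective (reducedHomologyMap k i h) := by
  intro x
  obtain ⟨⟨c, hc, hcycle⟩, rfl⟩ := Submodule.Quotient.mk_surjective _ x
  obtain ⟨d, hd, hcd⟩ := H c hc hcycle
  have hcycle' : simplicialBoundary k (c - simplicialBoundary k d) = 0 := by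
    rw [map_sub, simplicialBoundary_simplicialBoundary, sub_zero]
    exact hcycle
  refine ⟨Submodule.Quotient.mk ⟨c - simplicialBoundary k d, hcd, hcycle'⟩, ?_⟩
  rw [reducedHomologyMap_mk, Submodule.Quotient.eq]
  exact ⟨-d, Submodule.neg_mem _ hd, by simp⟩

/-- `H` expresses H_{i+1}(Γ, Δ) = 0. A filling in Γ of a cycle of Δ is a relative cycle; correcting
it by a boundary moves it into Δ without changing what it fills. -/
theorem reducedHomologyMap_injective {i : ℤ} {Δ Γ : LowerSet (Finset V)} (h : Δ ≤ Γ)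
    (H : ∀ c ∈ reducedChains k (i + 1) Γ, simplicialBoundary k c ∈ reducedChains k i Δ →
      ∃ d ∈ reducedChains k (i + 1 + 1) Γ,
        c - simplicialBoundary k d ∈ reducedChains k (i + 1) Δ) :
    Function.Injective (reducedHomologyMap k i h) := by
  rw [injective_iff_map_eq_zero]
  intro x
  obtain ⟨⟨c, hc, hcycle⟩, rfl⟩ := Submodule.Quotient.mk_surjective _ x
  intro hx
  rw [reducedHomologyMap_mk, Submodule.Quotient.mk_eq_zero] at hx
  obtain ⟨d, hd, hdc⟩ := hx
  replace hdc : simplicialBoundary k d = c := hdc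
  obtain ⟨e, -, hde⟩ := H d hd (hdc ▸ hc)
  refine (Submodule.Quotient.mk_eq_zero _).2 ⟨_, hde, ?_⟩
  rw [map_sub, simplicialBoundary_simplicialBoundary, sub_zero]
  exact hdc

end Boundary

/-! ### Complexes of lower sets of the lcm-lattice -/

section LcmComplex

variable {n r : ℕ} (g : Fin r → Fin n →₀ ℕ)

/-- The least common multiple of a set of generators, as an element of the lcm-lattice. -/
noncomputable def faceLcm (F : Finset (Fin r)) : LcmLattice g := ⟨F.sup g, F, rfl⟩

theorem faceLcm_mono : Monotone (faceLcm g) := fun _ _ h => Subtype.mk_le_mk.2 (Finset.sup_mono h)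

variable {g} in
theorem faceLcm_le_iff {F : Finset (Fin r)} {p : LcmLattice g} :
    faceLcm g F ≤ p ↔ F ≤ divisorLabel g p := by
  rw [← Subtype.coe_le_coe]
  simp [faceLcm, divisorLabel, Finset.subset_iff]

/-- The simplicial complex of the sets of generators whose least common multiple lies in a given
lower set of the lcm-lattice. -/
def lcmComplex (U : LowerSet (LcmLattice g)) : LowerSet (Finset (Fin r)) where
  carrier := {F | faceLcm g F ∈ U}
  lower' _ _ h hF := U.lower (faceLcm_mono g h) hF

variable {g} in
theorem mem_lcmComplex {U : LowerSet (LcmLattice g)} {F : Finset (Fin r)} :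
    F ∈ lcmComplex g U ↔ faceLcm g F ∈ U := Iff.rfl

theorem lcmComplex_mono {U W : LowerSet (LcmLattice g)} (h : U ≤ W) :
    lcmComplex g U ≤ lcmComplex g W := fun _ hF => h hF

theorem lcmComplex_Iic (p : LcmLattice g) :
    lcmComplex g (LowerSet.Iic p) = LowerSet.Iic (divisorLabel g p) := by
  ext F
  exact faceLcm_le_iff

theorem lcmComplex_lowerClosure (s : Set (LcmLattice g)) :
    lcmComplex g (lowerClosure s) = lowerClosure (divisorLabel g '' s) := by
  ext F
  simp [mem_lcmComplex, faceLcm_le_iff]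

theorem lcmComplex_Iio (p : LcmLattice g) :
    lcmComplex g (LowerSet.Iio p) = latticeComplex g p := by
  rw [latticeComplex, ← lcmComplex_lowerClosure]
  congr 1
  ext q
  exact ⟨fun h => (exists_le_covBy_of_lt h).imp fun _ h => h.symm,
    fun ⟨_, hβ, hq⟩ => lt_of_le_of_lt hq hβ.lt⟩

variable {k : Type*} [Field k] {i : ℤ}

variable {g} in
/-- Relative cycles of the simplex `A_p` modulo `Δ_p` are relative boundaries if
`H̃_{i-1}(Δ_p) = 0`. -/
theorem exists_sub_boundary_mem_Iio (hi : 0 ≤ i) {p : LcmLattice g}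
    (hp : ¬ Nontrivial (ReducedHomology k (i - 1) (latticeComplex g p)))
    {c : Finset (Fin r) → k} (hc : c ∈ reducedChains k i (lcmComplex g (LowerSet.Iic p)))
    (hbd : simplicialBoundary k c ∈ reducedChains k (i - 1) (lcmComplex g (LowerSet.Iio p))) :
    ∃ d ∈ reducedChains k (i + 1) (lcmComplex g (LowerSet.Iic p)),
      c - simplicialBoundary k d ∈ reducedChains k i (lcmComplex g (LowerSet.Iio p)) := by
  rw [← lcmComplex_Iio] at hp
  -- Fill ∂c by e inside Δ_p. Then c - e is a cycle of the simplex A_p, hence some ∂d, and c - ∂d =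
  -- e.
  obtain ⟨e, he, hec⟩ := mem_reducedBoundaries_of_not_nontrivial hp hbd
    (simplicialBoundary_simplicialBoundary c)
  rw [sub_add_cancel] at he
  have hlt : LowerSet.Iio p ≤ LowerSet.Iic p := fun _ h => LowerSet.mem_Iic_iff.2 (LowerSet.mem_Iio_iff.1 h).le
  have hce := Submodule.sub_mem _ hc (reducedChains_mono k i (lcmComplex_mono g hlt) he)
  rw [lcmComplex_Iic] at hce ⊢
  obtain ⟨d, hd, hdc⟩ := exists_boundary_eq_of_isCycle_simplex hi _ hce
    (by rw [map_sub, hec, sub_self])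
  exact ⟨d, hd, by rwa [hdc, sub_sub_cancel]⟩

variable {g} in
/-- If `H̃_{i-1}(Δ_p) = 0` for all `p ∈ W \ U`, then the complex of `W` modulo that of `U` has no
homology in degree `i`. -/
theorem exists_sub_boundary_mem_lcmComplex (hi : 0 ≤ i) (U W : LowerSet (LcmLattice g))
    (hUW : U ≤ W)
    (h : ∀ p ∈ W, p ∉ U → ¬ Nontrivial (ReducedHomology k (i - 1) (latticeComplex g p)))
    {c : Finset (Fin r) → k} (hc : c ∈ reducedChains k i (lcmComplex g W))
    (hbd : simplicialBoundary k c ∈ reducedChains k (i - 1) (lcmComplex g U)) :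
    ∃ d ∈ reducedChains k (i + 1) (lcmComplex g W),
      c - simplicialBoundary k d ∈ reducedChains k i (lcmComplex g U) := by
  classical
  induction W using WellFoundedLT.induction generalizing c with
  | ind W ih =>
  rcases hUW.eq_or_lt with rfl | hlt
  · exact ⟨0, Submodule.zero_mem _, by rwa [map_zero, sub_zero]⟩
  obtain ⟨q, hqW, hqU⟩ := Set.exists_of_ssubset hlt
  obtain ⟨p, -, hp⟩ := (Set.toFinite {x | x ∈ W ∧ x ∉ U}).exists_le_maximal
    (show q ∈ {x | x ∈ W ∧ x ∉ U} from ⟨hqW, hqU⟩)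
  have hpW : p ∈ W := hp.prop.1
  have hpU : p ∉ U := hp.prop.2
  -- p is maximal in all of `W`: an element of `U` above p would put p in `U`.
  have hmax : ∀ x ∈ W, p ≤ x → x = p := fun x hx hpx =>
    (hp.eq_of_le ⟨hx, fun hxU => hpU (U.lower hpx hxU)⟩ hpx).symm
  -- The part of c on the faces that disappear when p is removed.
  let c' : Finset (Fin r) → k := fun F => if faceLcm g F = p then c F else 0
  have hc' : c' ∈ reducedChains k i (lcmComplex g (LowerSet.Iic p)) := by
    intro F hF
    have hFp : faceLcm g F = p := by
      by_contra hne
      exact hF (if_neg hne)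
    exact ⟨hFp.le, (hc F fun h0 => hF (by simp [c', h0])).2⟩
  have hbd' : simplicialBoundary k c' ∈
      reducedChains k (i - 1) (lcmComplex g (LowerSet.Iio p)) := by
    intro G hG
    have hmem := simplicialBoundary_mem_reducedChains
      (i := i - 1) ((sub_add_cancel i 1).symm ▸ hc') G hG
    refine ⟨mem_lcmComplex.2 (LowerSet.mem_Iio_iff.2
      (lt_of_le_of_ne (mem_lcmComplex.1 hmem.1) fun hGp => ?_)), hmem.2⟩
    -- If G has lcm p, every face of c containing G has lcm p too, by maximality. So c and c' have
    -- the same boundary coefficient at G, which would force p into `U`.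
    have heq : simplicialBoundary k c' G = simplicialBoundary k c G := by
      rw [simplicialBoundary_apply, simplicialBoundary_apply]
      refine Finset.sum_congr rfl fun v _ => congrArg _ (ite_eq_left_iff.2 fun hne => ?_)
      by_contra h0
      exact hne (hmax _ (hc _ (Ne.symm h0)).1
        (hGp ▸ faceLcm_mono g (Finset.subset_insert v G)))
    rw [heq] at hG
    exact hpU (hGp ▸ (hbd G hG).1)
  obtain ⟨d, hd, hcd⟩ := exists_sub_boundary_mem_Iio hi (h p hpW hpU) hc' hbd'
  let W' : LowerSet (LcmLattice g) :=
    ⟨{x | x ∈ W ∧ x ≠ p}, fun x y hyx hx => ⟨W.lower hyx hx.1, fun hy =>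
      hx.2 (hmax x hx.1 (hy ▸ hyx))⟩⟩
  have hW'W : W' ≤ W := fun _ hx => hx.1
  have hUW' : U ≤ W' := fun x hx => ⟨hUW hx, fun hxp => hpU (hxp ▸ hx)⟩
  have hltW : W' < W := lt_of_le_of_ne hW'W fun heq => (heq.ge hpW : p ∈ W').2 rfl
  have hIio : LowerSet.Iio p ≤ W' := fun x hx => ⟨W.lower (le_of_lt hx) hpW, ne_of_lt hx⟩
  have hIic : LowerSet.Iic p ≤ W := fun x hx => W.lower hx hpW
  have hdW := reducedChains_mono k (i + 1) (lcmComplex_mono g hIic) hd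
  have hrest : c - c' ∈ reducedChains k i (lcmComplex g W') := by
    intro F hF
    by_cases hFp : faceLcm g F = p
    · simp [c', hFp] at hF
    · simp only [Pi.sub_apply, c', if_neg hFp, sub_zero] at hF
      exact ⟨⟨(hc F hF).1, hFp⟩, (hc F hF).2⟩
  have hcW' : c - simplicialBoundary k d ∈ reducedChains k i (lcmComplex g W') := by
    rw [← sub_add_sub_cancel c c' (simplicialBoundary k d)]
    exact Submodule.add_mem _ hrest (reducedChains_mono k i (lcmComplex_mono g hIio) hcd)
  obtain ⟨e, he, hce⟩ := ih W' hltW hUW' (fun x hx => h x (hW'W hx)) hcW'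
    (by rwa [map_sub, simplicialBoundary_simplicialBoundary, sub_zero])
  refine ⟨d + e, Submodule.add_mem _ hdW
    (reducedChains_mono k (i + 1) (lcmComplex_mono g hW'W) he), ?_⟩
  rwa [map_add, ← sub_sub]

end LcmComplex

/-! ### The comparison map σ -/

theorem mainTheorem12 {k : Type*} [Field k] {n r : ℕ}
    (M : Ideal (MvPolynomial (Fin n) k)) (g : Fin r → Fin n →₀ ℕ)
    (hM : IsMinimallyGeneratedBy M g)
    (m : LcmLattice g) (hmB : m ∈ bettiPoset k g) (hm1 : m ≠ ⊥) (hma : ¬ IsAtom m)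
    (i : ℤ) (hi : 0 ≤ i) :
    Function.Surjective (reducedHomologyMap k i (approxComplex_le k g i m)) ∧
    ((¬ ∃ p ∈ uncoveredBelow k g i m, Nontrivial (ReducedHomology k i (latticeComplex g p))) →
      Function.Bijective (reducedHomologyMap k i (approxComplex_le k g i m))) := by
  let U : LowerSet (LcmLattice g) := lowerClosure (maximalBettiBelow k g i m)
  have hU : lcmComplex g U = approxComplex k g i m := lcmComplex_lowerClosure g _
  have hW : lcmComplex g (LowerSet.Iio m) = latticeComplex g m := lcmComplex_Iio g m
  have hUW : U ≤ LowerSet.Iio m :=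
    lowerClosure_min (fun γ hγ => hγ.prop.2.2.1) (LowerSet.lower _)
  have hsurj : Function.Surjective (reducedHomologyMap k i (approxComplex_le k g i m)) := by
    refine reducedHomologyMap_surjective _ fun c hc hcycle => ?_
    rw [← hW] at hc ⊢
    rw [← hU]
    refine exists_sub_boundary_mem_lcmComplex hi U _ hUW (fun p hpm hpU hp => hpU ?_) hc
      (hcycle ▸ Submodule.zero_mem _)
    -- 𝓑_i(m) excludes 1 by definition; nothing is lost, as Δ_1 has no faces and hence no homology.
    have hp_ne : p ≠ ⊥ := by
      rintro rfl
      have hvoid : latticeComplex g (⊥ : LcmLattice g) = ⊥ := by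
        simp [latticeComplex, not_covBy_bot]
      obtain ⟨x, hx⟩ := exists_ne (0 : ReducedHomology k (i - 1) (latticeComplex g ⊥))
      obtain ⟨⟨z, hz⟩, rfl⟩ := Submodule.Quotient.mk_surjective _ x
      refine hx ((Submodule.Quotient.mk_eq_zero _).2 ⟨0, Submodule.zero_mem _, ?_⟩)
      rw [map_zero]
      ext F
      by_contra h
      exact (hvoid ▸ (hz.1 F (Ne.symm h)).1 : F ∈ (⊥ : LowerSet (Finset (Fin r))))
    obtain ⟨γ, hpγ, hγ⟩ := (Set.toFinite (bettiBelow k g i m)).exists_le_maximal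
      (show p ∈ bettiBelow k g i m from ⟨Or.inr ⟨_, hp⟩, hp_ne, hpm, hp⟩)
    exact ⟨γ, hγ, hpγ⟩
  refine ⟨hsurj, fun hJ => ⟨reducedHomologyMap_injective _ fun c hc hbd => ?_, hsurj⟩⟩
  rw [← hW] at hc ⊢
  rw [← hU] at hbd ⊢
  refine exists_sub_boundary_mem_lcmComplex (by omega) U _ hUW (fun p hpm hpU hp => hJ ?_) hc
    (by rwa [add_sub_cancel_right])
  rw [add_sub_cancel_right] at hp
  -- Lying outside `U` means p ≤ γ for no γ, which is stronger than the p < γ for no γ required by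
  -- 𝓙_i(m).
  exact ⟨p, ⟨hpm, fun ⟨γ, hγ, hpγ⟩ => hpU ⟨γ, hγ, hpγ.le⟩⟩, hp⟩
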